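/- Let $K$ be a field. A numerical semigroup is a submonoid $\Gamma\subseteq\mathbb N$ with finite complement. Its pseudo-Frobenius numbers are the elements of $\mathrm{PF}(\Gamma)=\{\nu\in\mathbb Z\setminus\Gamma : \nu+s\in\Gamma \text{ for all } s\in\Gamma\setminus\{0\}\}$. Let $K[\Gamma]=K[t^s : s\in\Gamma]\subseteq K(t)$, let $\omega_\Gamma$ be its canonical module, realized as the $K[\Gamma]$-submodule of $K(t)$ generated by the $t^{-\nu}$ with $\nu\in\mathrm{PF}(\Gamma)$, and let $\omega_\Gamma^{-1}=\{x\in K(t): x\,\omega_\Gamma\subseteq K[\Gamma]\}$. Write $\Omega_\Gamma=\{z\in\mathbb Z: t^z\in\omega_\Gamma\}$ and $\Omega_\Gamma^{-1}=\{z\in\mathbb Z: t^z\in\omega_\Gamma^{-1}\}$. The trace of $\Gamma$ is $\mathrm{tr}(\Gamma)=\Omega_\Gamma+\Omega_\Gamma^{-1}$, and the residue of $\Gamma$ is $\mathrm{res}(\Gamma)=\dim_K K[\Gamma]/\mathrm{tr}(\omega_\Gamma)$, where $\mathrm{tr}(\omega_\Gamma)=\sum_{\varphi\in\mathrm{Hom}_{K[\Gamma]}(\omega_\Gamma,K[\Gamma])}\varphi(\omega_\Gamma)$.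 Let $\Gamma_1=\langle m_1,\dots,m_l\rangle$ and $\Gamma_2=\langle n_1,\dots,n_k\rangle$ be numerical semigroups, minimally generated by $m_1<\cdots<m_l$ and $n_1<\cdots<n_k$. Let $\lambda\in\Gamma_1$ and $\mu\in\Gamma_2$ be positive integers with $\gcd(\lambda,\mu)=1$, $\lambda\notin\{m_1,\dots,m_l\}$, $\mu\notin\{n_1,\dots,n_k\}$ and $\{\mu m_1,\dots,\mu m_l\}\cap\{\lambda n_1,\dots,\lambda n_k\}=\emptyset$, and let $\Gamma_1\#_{\lambda,\mu}\Gamma_2=\langle \mu m_1,\dots,\mu m_l,\lambda n_1,\dots,\lambda n_k\rangle$ be their gluing. Then (i) $\mathrm{tr}(\Gamma_1\#_{\lambda,\mu}\Gamma_2)=\mu\,\mathrm{tr}(\Gamma_1)+\lambda\,\mathrm{tr}(\Gamma_2)=\{\mu x+\lambda y : x\in\mathrm{tr}(\Gamma_1),\ y\in\mathrm{tr}(\Gamma_2)\}$; (ii) $\mathrm{res}(\Gamma_1\#_{\lambda,\mu}\Gamma_2)$ is finite and equals $\mu\,\mathrm{res}(\Gamma_1)+\lambda\,\mathrm{res}(\Gamma_2)$.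 -/

import Mathlib

/-- A numerical semigroup: a submonoid of `ℕ` with finite complement. -/
def IsNumericalSemigroup (Γ : AddSubmonoid ℕ) : Prop :=
  ((Γ : Set ℕ)ᶜ).Finite

/-- The semigroup `⟨n₁, …, nₑ⟩` generated by a finite family of natural numbers. -/
def semigroupGeneratedBy {e : ℕ} (n : Fin e → ℕ) : AddSubmonoid ℕ :=
  AddSubmonoid.closure (Set.range n)

/-- `n₁ < ⋯ < nₑ` minimally generate a numerical semigroup. -/
structure MinimallyGeneratesNumericalSemigroup {e : ℕ} (n : Fin e → ℕ) : Prop where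
  numerical : IsNumericalSemigroup (semigroupGeneratedBy n)
  strictMono : StrictMono n
  minimal : ∀ i, n i ∉ AddSubmonoid.closure (n '' {j | j ≠ i})

/-- The pseudo-Frobenius numbers of `Γ`: the integers `ν ∉ Γ` with `ν + s ∈ Γ` for all nonzero
`s ∈ Γ`. For a numerical semigroup `Γ ≠ ℕ` they are all gaps (positive); for `Γ = ℕ` the only one
is `-1`. -/
def pseudoFrobenius (Γ : AddSubmonoid ℕ) : Set ℤ :=
  {ν | (¬ ∃ a ∈ Γ, (a : ℤ) = ν) ∧ ∀ s ∈ Γ, s ≠ 0 → ∃ a ∈ Γ, (a : ℤ) = ν + (s : ℤ)}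

noncomputable section

/-- The monomial `t ^ z` (`z ∈ ℤ`) in the field `K(t)`. -/
def monomialT (K : Type*) [Field K] (z : ℤ) : RatFunc K := RatFunc.X ^ z

/-- The semigroup ring `K[Γ] = K[t ^ s : s ∈ Γ]` as a subalgebra of `K(t)`, which is its quotient
field when `Γ` is a numerical semigroup. -/
def semigroupRing (K : Type*) [Field K] (Γ : AddSubmonoid ℕ) : Subalgebra K (RatFunc K) :=
  Algebra.adjoin K {f | ∃ s ∈ Γ, f = monomialT K (s : ℤ)}

/-- The canonical module of `K[Γ]`, as a fractional ideal: it is generated by the `t ^ (-ν)`, for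
`ν` a pseudo-Frobenius number of `Γ`. -/
def canonicalModule (K : Type*) [Field K] (Γ : AddSubmonoid ℕ) :
    Submodule (semigroupRing K Γ) (RatFunc K) :=
  Submodule.span (semigroupRing K Γ) ((fun ν => monomialT K (-ν)) '' pseudoFrobenius Γ)

/-- The anti-canonical ideal `{x ∈ K(t) : x • ω ⊆ K[Γ]}`. -/
def anticanonicalIdeal (K : Type*) [Field K] (Γ : AddSubmonoid ℕ) :
    Submodule (semigroupRing K Γ) (RatFunc K) :=
  1 / canonicalModule K Γ

/-- The set of exponents of the monomials lying in a subset of `K(t)`. -/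
def monomialExponents {K : Type*} [Field K] (I : Set (RatFunc K)) : Set ℤ :=
  {z | monomialT K z ∈ I}

/-- The trace of a semigroup: `tr(Γ) = Ω + Ω⁻¹`, where `Ω` and `Ω⁻¹` are the sets of exponents of
the monomials in the canonical module and in the anti-canonical ideal of `K[Γ]`. -/
def semigroupTrace (K : Type*) [Field K] (Γ : AddSubmonoid ℕ) : Set ℤ :=
  {z | ∃ x ∈ monomialExponents (canonicalModule K Γ : Set (RatFunc K)),
    ∃ y ∈ monomialExponents (anticanonicalIdeal K Γ : Set (RatFunc K)), z = x + y}

/-- The trace ideal `tr_A(N) = ∑ φ(N)`, over all `φ ∈ Hom_A(N, A)`. -/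
def traceIdeal (A N : Type*) [CommRing A] [AddCommGroup N] [Module A N] : Ideal A :=
  ⨆ φ : N →ₗ[A] A, LinearMap.range φ

/-- The residue `res(Γ) = dim_K K[Γ] / tr(ω)`, where `ω` is the canonical module of `K[Γ]`
(`⊤` if the dimension is infinite). -/
def residue (K : Type*) [Field K] (Γ : AddSubmonoid ℕ) : ℕ∞ :=
  Cardinal.toENat
    (Module.rank K (semigroupRing K Γ ⧸ traceIdeal (semigroupRing K Γ) (canonicalModule K Γ)))

end

/-- The conditions under which the semigroups with minimal generators `m₁ < ⋯ < mₗ` and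
`n₁ < ⋯ < nₖ` can be glued with respect to `lam` and `mu`. -/
structure IsGluingData {l k : ℕ} (m : Fin l → ℕ) (n : Fin k → ℕ) (lam mu : ℕ) : Prop where
  left : MinimallyGeneratesNumericalSemigroup m
  right : MinimallyGeneratesNumericalSemigroup n
  lam_pos : 0 < lam
  mu_pos : 0 < mu
  lam_mem : lam ∈ semigroupGeneratedBy m
  mu_mem : mu ∈ semigroupGeneratedBy n
  coprime : Nat.gcd lam mu = 1
  lam_notMem : lam ∉ Set.range m
  mu_notMem : mu ∉ Set.range n
  disjoint : Disjoint (Set.range fun i => mu * m i) (Set.range fun j => lam * n j)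

/-- The gluing `⟨mu m₁, …, mu mₗ, lam n₁, …, lam nₖ⟩`. -/
def gluing {l k : ℕ} (m : Fin l → ℕ) (n : Fin k → ℕ) (lam mu : ℕ) : AddSubmonoid ℕ :=
  AddSubmonoid.closure ((Set.range fun i => mu * m i) ∪ (Set.range fun j => lam * n j))

/-!
The theorem is a statement about exponents. By the Laurent expansion at `0`, the monomials `t ^ z`
are linearly independent over `K`, and the semigroup ring, the canonical module, its inverse and the
trace ideal are all spanned by the monomials they contain. With `G ⊆ ℤ` the image of `Γ`, the
exponents of `ω` are the `w` with `-w ∉ G` (`mem_canonicalModule_iff`), those of `ω⁻¹` are the `y`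
with `y + w ∈ G` for all such `w` (`mem_anticanonicalIdeal_iff`), and those of the trace ideal are
the sums (`mem_traceIdeal_iff`; homomorphisms `ω → K[Γ]` are multiplications by elements of `ω⁻¹`).
Hence the residue is the number of elements of `Γ` outside its trace (`residue_eq_encard`).

The image in `ℤ` of a gluing is `G = p G₁ + q G₂`, with `p = mu ∈ G₂` and `q = lam ∈ G₁` coprime.
Representations of an integer as `p a + q b` differ by moves `(a, b) ↦ (a - q s, b + p s)`. So if
`a` is an Apéry element of a set `I` stable under adding `q`, and `J` is stable under adding `p`,
then `p a + q b ∈ p I + q J` already forces `b ∈ J` (`mem_right_of_mem_weightedSum`). Two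
consequences carry the theorem:

* the exponents of `ω` and of `ω⁻¹` for `G` are the weighted sums of those for `G₁` and `G₂`,
  shifted by `-p q` and `p q` respectively, and the shifts cancel in the trace
  (`traceExponents_weightedSum`);
* taking for `b` the Apéry elements of `J` with respect to `p`, one in each of the `p` residue
  classes, identifies `p I + q J` with `I × Fin p`, so that `(p I + q J) \ (p I' + q J)` has
  `p |I \ I'|` elements (`encard_weightedSum_diff_left`). Applied along the chain
  `p G₁ + q G₂ ⊇ p T₁ + q G₂ ⊇ p T₁ + q T₂`, with `Tᵢ` the trace of `Gᵢ`, this gives the formula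
  for the residue.
-/

/-! ### Sets of integers commensurable with `ℕ` -/

/-- A set of integers that is bounded below and contains all sufficiently large integers: the
exponent set of a nonzero monomial fractional ideal has this shape. -/
structure IsRightCofinite (S : Set ℤ) : Prop where
  bddBelow : ∃ B, ∀ z ∈ S, B ≤ z
  eventually_mem : ∃ N, ∀ z, N ≤ z → z ∈ S

/-- The elements `p x + q y` with `x ∈ I` and `y ∈ J`. -/
def weightedSum (p q : ℤ) (I J : Set ℤ) : Set ℤ :=
  {z | ∃ x ∈ I, ∃ y ∈ J, z = p * x + q * y}

/-- The exponent set of the canonical module: minus the complement of `G`. -/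
def canonicalExponents (G : Set ℤ) : Set ℤ := {z | -z ∉ G}

/-- The integers that translate `canonicalExponents G` into `G`. -/
def anticanonicalExponents (G : Set ℤ) : Set ℤ := {y | ∀ w ∈ canonicalExponents G, y + w ∈ G}

/-- The sumset of `canonicalExponents G` and `anticanonicalExponents G`. -/
def traceExponents (G : Set ℤ) : Set ℤ :=
  {z | ∃ x ∈ canonicalExponents G, ∃ y ∈ anticanonicalExponents G, z = x + y}

lemma weightedSum_comm (p q : ℤ) (I J : Set ℤ) : weightedSum p q I J = weightedSum q p J I := by
  ext z
  constructor
  · rintro ⟨x, hx, y, hy, rfl⟩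
    exact ⟨y, hy, x, hx, add_comm _ _⟩
  · rintro ⟨x, hx, y, hy, rfl⟩
    exact ⟨y, hy, x, hx, add_comm _ _⟩

lemma weightedSum_mono {p q : ℤ} {I I' J J' : Set ℤ} (hI : I' ⊆ I) (hJ : J' ⊆ J) :
    weightedSum p q I' J' ⊆ weightedSum p q I J := by
  rintro _ ⟨x, hx, y, hy, rfl⟩
  exact ⟨x, hI hx, y, hJ hy, rfl⟩

lemma add_mul_natCast_mem {S : Set ℤ} {d : ℤ} (hS : ∀ z ∈ S, z + d ∈ S) {x : ℤ} (hx : x ∈ S)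
    (n : ℕ) : x + d * n ∈ S := by
  induction n with
  | zero => simpa using hx
  | succ n ih => simpa [mul_add, add_assoc] using hS _ ih

/-- Each residue class modulo `d > 0` has an Apéry element in `S`: one that leaves `S` when `d` is
subtracted. -/
lemma IsRightCofinite.exists_apery {S : Set ℤ} (hS : IsRightCofinite S) {d : ℤ} (hd : 0 < d)
    (c : ℤ) : ∃ s : ℤ, c + d * s ∈ S ∧ c + d * s - d ∉ S := by
  obtain ⟨B, hB⟩ := hS.bddBelow
  obtain ⟨N, hN⟩ := hS.eventually_mem
  obtain ⟨s, hs, hmin⟩ := Int.exists_least_of_bdd (P := fun s => c + d * s ∈ S)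
    ⟨-|B - c|, fun s hs => by
      have h1 := hB _ hs
      have h2 := neg_abs_le (B - c)
      by_contra! h3
      have h4 : 0 ≤ |B - c| := abs_nonneg _
      nlinarith⟩
    ⟨|N - c|, hN _ (by nlinarith [le_abs_self (N - c), abs_nonneg (N - c)])⟩
  refine ⟨s, hs, fun h => ?_⟩
  have := hmin (s - 1) (by simpa [mul_sub, add_sub_assoc] using h)
  omega

/-- The basic rigidity of weighted sums: if `x` cannot be lowered by `q` within `I`, then
`p x + q y` lies in the weighted sum only if `y ∈ J`. -/
lemma mem_right_of_mem_weightedSum {p q : ℤ} (hq : 0 < q) (hpq : IsCoprime p q)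
    {I J : Set ℤ} (hI : ∀ z ∈ I, z + q ∈ I) (hJ : ∀ z ∈ J, z + p ∈ J) {a b : ℤ}
    (h : p * a + q * b ∈ weightedSum p q I J) (ha : a - q ∉ I) : b ∈ J := by
  obtain ⟨x, hx, y, hy, hxy⟩ := h
  obtain ⟨s, hs⟩ : q ∣ a - x :=
    hpq.symm.dvd_of_dvd_mul_left ⟨y - b, by linear_combination hxy⟩
  have hb : b = y - p * s := by
    have : q * (b - (y - p * s)) = 0 := by linear_combination hxy - p * hs
    rcases mul_eq_zero.1 this with h | h <;> omega
  have hs0 : s ≤ 0 := by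
    by_contra! h0
    obtain ⟨n, hn⟩ := Int.eq_ofNat_of_zero_le (show 0 ≤ s - 1 by omega)
    refine ha ?_
    have := add_mul_natCast_mem hI hx n
    rw [← hn] at this
    convert this using 1
    linear_combination hs
  obtain ⟨n, hn⟩ := Int.eq_ofNat_of_zero_le (show 0 ≤ -s by omega)
  have := add_mul_natCast_mem hJ hy n
  rw [← hn] at this
  convert this using 1
  linear_combination hb

lemma mem_left_of_mem_weightedSum {p q : ℤ} (hp : 0 < p) (hpq : IsCoprime p q)
    {I J : Set ℤ} (hI : ∀ z ∈ I, z + q ∈ I) (hJ : ∀ z ∈ J, z + p ∈ J) {a b : ℤ}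
    (h : p * a + q * b ∈ weightedSum p q I J) (hb : b - p ∉ J) : a ∈ I :=
  mem_right_of_mem_weightedSum hp hpq.symm hJ hI
    (by rwa [weightedSum_comm, add_comm] at h) hb

/-- Every integer is `p a + q b` with `a` an Apéry element of `I` with respect to `q`. -/
lemma exists_eq_mul_add_mul_apery {p q : ℤ} (hq : 0 < q) (hpq : IsCoprime p q)
    {I : Set ℤ} (hI : IsRightCofinite I) (z : ℤ) :
    ∃ a b, z = p * a + q * b ∧ a ∈ I ∧ a - q ∉ I := by
  obtain ⟨u, v, huv⟩ := hpq
  obtain ⟨s, hs, hs'⟩ := hI.exists_apery hq (z * u)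
  exact ⟨_, z * v - p * s, by linear_combination -z * huv, hs, hs'⟩

lemma IsRightCofinite.weightedSum {p q : ℤ} (hp : 0 < p) (hq : 0 < q) (hpq : IsCoprime p q)
    {I J : Set ℤ} (hI : IsRightCofinite I) (hJ : IsRightCofinite J) :
    IsRightCofinite (weightedSum p q I J) := by
  obtain ⟨A, hA⟩ := hI.bddBelow
  obtain ⟨B, hB⟩ := hJ.bddBelow
  obtain ⟨M, hM⟩ := hI.eventually_mem
  obtain ⟨N, hN⟩ := hJ.eventually_mem
  refine ⟨⟨p * A + q * B, ?_⟩, ⟨p * (M + q) + q * N, fun z hz => ?_⟩⟩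
  · rintro _ ⟨x, hx, y, hy, rfl⟩
    have := hA x hx
    have := hB y hy
    gcongr
  · obtain ⟨a, b, rfl, ha, ha'⟩ := exists_eq_mul_add_mul_apery hq hpq hI z
    refine ⟨a, ha, b, hN b ?_, rfl⟩
    have : a - q < M := by
      by_contra! h
      exact ha' (hM _ h)
    nlinarith

/-! ### Canonical and anticanonical exponents -/

section Semigroup

variable {G : AddSubmonoid ℤ}

lemma canonicalExponents_add_mem {w s : ℤ} (hw : w ∈ canonicalExponents (G : Set ℤ))
    (hs : s ∈ G) : w + s ∈ canonicalExponents (G : Set ℤ) := fun h => hw <| by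
  have := G.add_mem h hs
  rwa [neg_add, neg_add_cancel_right] at this

lemma anticanonicalExponents_add_mem {w s : ℤ}
    (hw : w ∈ anticanonicalExponents (G : Set ℤ)) (hs : s ∈ G) :
    w + s ∈ anticanonicalExponents (G : Set ℤ) := fun v hv => by
  have := G.add_mem (hw v hv) hs
  rwa [add_right_comm] at this

lemma traceExponents_add_mem {w s : ℤ} (hw : w ∈ traceExponents (G : Set ℤ)) (hs : s ∈ G) :
    w + s ∈ traceExponents (G : Set ℤ) := by
  obtain ⟨x, hx, y, hy, rfl⟩ := hw
  exact ⟨x, hx, y + s, anticanonicalExponents_add_mem hy hs, add_assoc _ _ _⟩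

lemma traceExponents_subset (G : Set ℤ) : traceExponents G ⊆ G := by
  rintro _ ⟨x, hx, y, hy, rfl⟩
  rw [add_comm]
  exact hy x hx

lemma canonicalExponents_isRightCofinite {G : Set ℤ} (hG : IsRightCofinite G) :
    IsRightCofinite (canonicalExponents G) := by
  obtain ⟨B, hB⟩ := hG.bddBelow
  obtain ⟨N, hN⟩ := hG.eventually_mem
  refine ⟨⟨-N, fun z hz => ?_⟩, ⟨-B + 1, fun z hz h => ?_⟩⟩
  · by_contra! h
    exact hz (hN _ (by omega))
  · have := hB _ h
    omega

lemma anticanonicalExponents_isRightCofinite {G : Set ℤ} (hG : IsRightCofinite G) :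
    IsRightCofinite (anticanonicalExponents G) := by
  obtain ⟨A, hA⟩ := (canonicalExponents_isRightCofinite hG).bddBelow
  obtain ⟨M, hM⟩ := (canonicalExponents_isRightCofinite hG).eventually_mem
  obtain ⟨B, hB⟩ := hG.bddBelow
  obtain ⟨N, hN⟩ := hG.eventually_mem
  refine ⟨⟨B - M, fun y hy => ?_⟩, ⟨N - A, fun y hy w hw => hN _ ?_⟩⟩
  · have := hB _ (hy M (hM M le_rfl))
    omega
  · have := hA w hw
    omega

lemma traceExponents_isRightCofinite {G : Set ℤ} (hG : IsRightCofinite G) :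
    IsRightCofinite (traceExponents G) := by
  obtain ⟨B, hB⟩ := hG.bddBelow
  obtain ⟨M, hM⟩ := (canonicalExponents_isRightCofinite hG).eventually_mem
  obtain ⟨N, hN⟩ := (anticanonicalExponents_isRightCofinite hG).eventually_mem
  exact ⟨⟨B, fun z hz => hB z (traceExponents_subset G hz)⟩,
    ⟨M + N, fun z hz => ⟨M, hM M le_rfl, z - M, hN _ (by omega), by omega⟩⟩⟩

/-! ### Exponents of a gluing -/

variable {G₁ G₂ : AddSubmonoid ℤ} {p q : ℤ}

/-- The complement of a gluing is the weighted sum of the two complements, shifted by `p q`. -/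
lemma notMem_weightedSum_iff (hq : 0 < q) (hpq : IsCoprime p q)
    (h₁ : IsRightCofinite (G₁ : Set ℤ)) (hq₁ : q ∈ G₁) (hp₂ : p ∈ G₂) (z : ℤ) :
    z ∉ weightedSum p q (G₁ : Set ℤ) G₂ ↔
      ∃ a b, a ∉ G₁ ∧ b ∉ G₂ ∧ z = p * a + q * b + p * q := by
  constructor
  · intro hz
    obtain ⟨a, b, rfl, ha, ha'⟩ := exists_eq_mul_add_mul_apery hq hpq h₁ z
    exact ⟨a - q, b, ha', fun hb => hz ⟨a, ha, b, hb, rfl⟩, by ring⟩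
  · rintro ⟨a, b, ha, hb, rfl⟩ h
    refine hb (mem_right_of_mem_weightedSum (a := a + q) hq hpq
      (fun z hz => G₁.add_mem hz hq₁) (fun z hz => G₂.add_mem hz hp₂) ?_ (by simpa using ha))
    convert h using 1
    ring

lemma mem_canonicalExponents_weightedSum (hq : 0 < q) (hpq : IsCoprime p q)
    (h₁ : IsRightCofinite (G₁ : Set ℤ)) (hq₁ : q ∈ G₁) (hp₂ : p ∈ G₂) (z : ℤ) :
    z ∈ canonicalExponents (weightedSum p q (G₁ : Set ℤ) G₂) ↔
      z + p * q ∈ weightedSum p q (canonicalExponents (G₁ : Set ℤ))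
        (canonicalExponents (G₂ : Set ℤ)) := by
  refine (notMem_weightedSum_iff hq hpq h₁ hq₁ hp₂ (-z)).trans ?_
  constructor
  · rintro ⟨a, b, ha, hb, h⟩
    exact ⟨-a, by simpa [canonicalExponents] using ha, -b,
      by simpa [canonicalExponents] using hb, by linear_combination -h⟩
  · rintro ⟨x, hx, y, hy, h⟩
    exact ⟨-x, -y, hx, hy, by linear_combination -h⟩

lemma mem_anticanonicalExponents_weightedSum (hq : 0 < q) (hpq : IsCoprime p q)
    (h₁ : IsRightCofinite (G₁ : Set ℤ)) (hq₁ : q ∈ G₁) (hp₂ : p ∈ G₂) (z : ℤ) :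
    z ∈ anticanonicalExponents (weightedSum p q (G₁ : Set ℤ) G₂) ↔
      z - p * q ∈ weightedSum p q (anticanonicalExponents (G₁ : Set ℤ))
        (anticanonicalExponents (G₂ : Set ℤ)) := by
  constructor
  · intro hz
    obtain ⟨a, b, hab, ha, ha'⟩ := exists_eq_mul_add_mul_apery hq hpq
      (anticanonicalExponents_isRightCofinite h₁) (z - p * q)
    refine ⟨a, ha, b, fun v hv => ?_, hab⟩
    -- The failure of `a - q` to be anticanonical is witnessed by some `w`, for which
    -- `a + w` cannot be lowered by `q` within `G₁`.
    obtain ⟨w, hw, hw'⟩ : ∃ w ∈ canonicalExponents (G₁ : Set ℤ), a - q + w ∉ G₁ := by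
      by_contra! h
      exact ha' h
    have key := hz (p * w + q * v - p * q)
      ((mem_canonicalExponents_weightedSum hq hpq h₁ hq₁ hp₂ _).2
        ⟨w, hw, v, hv, by ring⟩)
    refine mem_right_of_mem_weightedSum (a := a + w) hq hpq
      (fun z hz => G₁.add_mem hz hq₁) (fun z hz => G₂.add_mem hz hp₂) ?_
      (by rwa [add_sub_right_comm])
    convert key using 1
    linear_combination -hab
  · rintro ⟨a, ha, b, hb, hab⟩ w hw
    obtain ⟨x, hx, y, hy, hxy⟩ :=
      (mem_canonicalExponents_weightedSum hq hpq h₁ hq₁ hp₂ _).1 hw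
    exact ⟨a + x, ha x hx, b + y, hb y hy, by linear_combination hab + hxy⟩

/-- The opposite shifts by `p q` of the canonical and the anticanonical exponents cancel in the
trace. -/
lemma traceExponents_weightedSum (hq : 0 < q) (hpq : IsCoprime p q)
    (h₁ : IsRightCofinite (G₁ : Set ℤ)) (hq₁ : q ∈ G₁) (hp₂ : p ∈ G₂) :
    traceExponents (weightedSum p q (G₁ : Set ℤ) G₂) =
      weightedSum p q (traceExponents (G₁ : Set ℤ)) (traceExponents (G₂ : Set ℤ)) := by
  ext z
  constructor
  · rintro ⟨x, hx, y, hy, rfl⟩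
    obtain ⟨a, ha, b, hb, hab⟩ :=
      (mem_canonicalExponents_weightedSum hq hpq h₁ hq₁ hp₂ _).1 hx
    obtain ⟨c, hc, d, hd, hcd⟩ :=
      (mem_anticanonicalExponents_weightedSum hq hpq h₁ hq₁ hp₂ _).1 hy
    exact ⟨a + c, ⟨a, ha, c, hc, rfl⟩, b + d, ⟨b, hb, d, hd, rfl⟩,
      by linear_combination hab + hcd⟩
  · rintro ⟨_, ⟨a, ha, c, hc, rfl⟩, _, ⟨b, hb, d, hd, rfl⟩, rfl⟩
    exact ⟨p * a + q * b - p * q,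
      (mem_canonicalExponents_weightedSum hq hpq h₁ hq₁ hp₂ _).2 ⟨a, ha, b, hb, by ring⟩,
      p * c + q * d + p * q,
      (mem_anticanonicalExponents_weightedSum hq hpq h₁ hq₁ hp₂ _).2 ⟨c, hc, d, hd, by ring⟩,
      by ring⟩

/-! ### Counting in weighted sums -/

/-- Writing integers as `p a + q v` with `v` running over the Apéry elements of `J` with respect to
`p` identifies `weightedSum p q I J` with `I × Fin p`, compatibly for all `I`. -/
lemma encard_weightedSum_diff_left {p : ℕ} (hp : 0 < p)
    (hpq : IsCoprime (p : ℤ) q) {I I' J : Set ℤ} (hI : ∀ z ∈ I, z + q ∈ I)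
    (hI' : ∀ z ∈ I', z + q ∈ I') (hJ : ∀ z ∈ J, z + p ∈ J) (hJc : IsRightCofinite J) :
    (weightedSum p q I J \ weightedSum p q I' J).encard = p * (I \ I').encard := by
  have hp' : (0 : ℤ) < p := by exact_mod_cast hp
  choose s hs hs' using fun j : Fin p => hJc.exists_apery hp' (j : ℤ)
  set v : Fin p → ℤ := fun j => j + p * s j with hv
  have hmem : ∀ {I : Set ℤ}, (∀ z ∈ I, z + q ∈ I) → ∀ (a : ℤ) (j : Fin p),
      p * a + q * v j ∈ weightedSum p q I J ↔ a ∈ I := fun hI a j =>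
    ⟨fun h => mem_left_of_mem_weightedSum hp' hpq hI hJ h (hs' j),
      fun h => ⟨a, h, v j, hs j, rfl⟩⟩
  have hinj : Function.Injective fun x : ℤ × Fin p => p * x.1 + q * v x.2 := by
    rintro ⟨a, i⟩ ⟨b, j⟩ h
    simp only at h
    have h1 : (p : ℤ) ∣ v i - v j :=
      hpq.dvd_of_dvd_mul_left ⟨b - a, by linear_combination h⟩
    have h2 : (p : ℤ) ∣ (i : ℤ) - j := by
      have : (i : ℤ) - j = v i - v j - p * (s i - s j) := by simp only [hv]; ring
      rw [this]
      exact dvd_sub h1 (dvd_mul_right _ _)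
    have hij : i = j := by
      have h3 := Int.eq_zero_of_abs_lt_dvd h2 (by rw [abs_lt]; omega)
      exact Fin.ext (by omega)
    subst hij
    have h4 : (p : ℤ) * a = p * b := by linarith
    rw [mul_left_cancel₀ hp'.ne' h4]
  have himage : weightedSum p q I J \ weightedSum p q I' J =
      (fun x : ℤ × Fin p => p * x.1 + q * v x.2) '' ((I \ I') ×ˢ Set.univ) := by
    ext z
    constructor
    · intro hz
      obtain ⟨u, w, huw⟩ := hpq
      have hmod : 0 ≤ (z * w) % p := Int.emod_nonneg _ hp'.ne'
      have hlt : (z * w) % p < p := Int.emod_lt_of_pos _ hp'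
      let j : Fin p := ⟨((z * w) % p).toNat, by omega⟩
      have hj : ((j : ℕ) : ℤ) = (z * w) % p := Int.toNat_of_nonneg hmod
      have hzj : z = p * (z * u + q * ((z * w) / p - s j)) + q * v j := by
        have h5 := Int.emod_add_mul_ediv (z * w) p
        simp only [hv, hj]
        linear_combination -z * huw - q * h5
      rw [hzj] at hz ⊢
      exact ⟨(_, j), ⟨⟨(hmem hI _ j).1 hz.1, fun h => hz.2 ((hmem hI' _ j).2 h)⟩, trivial⟩, rfl⟩
    · rintro ⟨⟨a, j⟩, ⟨⟨h, h'⟩, -⟩, rfl⟩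
      exact ⟨(hmem hI a j).2 h, fun h6 => h' ((hmem hI' a j).1 h6)⟩
  rw [himage, hinj.encard_image, Set.encard_prod, Set.encard_univ, mul_comm]
  simp

/-- Passing from `I` to `I'` and then from `J` to `J'`. -/
lemma encard_weightedSum_diff {p q : ℕ} (hp : 0 < p) (hq : 0 < q)
    (hpq : IsCoprime (p : ℤ) q) {I I' J J' : Set ℤ} (hII : I' ⊆ I) (hJJ : J' ⊆ J)
    (hI : ∀ z ∈ I, z + q ∈ I) (hI' : ∀ z ∈ I', z + q ∈ I')
    (hJ : ∀ z ∈ J, z + p ∈ J) (hJ' : ∀ z ∈ J', z + p ∈ J')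
    (hIc : IsRightCofinite I') (hJc : IsRightCofinite J) :
    (weightedSum p q I J \ weightedSum p q I' J').encard =
      p * (I \ I').encard + q * (J \ J').encard := by
  rw [← encard_weightedSum_diff_left hp hpq hI hI' hJ hJc,
    ← encard_weightedSum_diff_left hq hpq.symm hJ hJ' hI' hIc,
    weightedSum_comm q p J, weightedSum_comm q p J',
    ← Set.encard_union_eq (Set.disjoint_left.2 fun z hz hz' => hz.2 hz'.1)]
  congr 1
  exact (Set.sdiff_union_sdiff_cancel (weightedSum_mono hII subset_rfl)
    (weightedSum_mono subset_rfl hJJ)).symm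

end Semigroup

/-! ### Monomial subspaces of `K(t)` -/

section Monomial

variable (K : Type*) [Field K]

lemma monomialT_add (x y : ℤ) : monomialT K (x + y) = monomialT K x * monomialT K y :=
  zpow_add₀ RatFunc.X_ne_zero x y

lemma monomialT_zero : monomialT K 0 = 1 := zpow_zero _

lemma monomialT_ne_zero (z : ℤ) : monomialT K z ≠ 0 := zpow_ne_zero z RatFunc.X_ne_zero

/-- The `K`-subspace of `K(t)` spanned by the monomials with exponent in `S`. -/
noncomputable def monomialSpan (S : Set ℤ) : Submodule K (RatFunc K) :=
  Submodule.span K (monomialT K '' S)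

open scoped RatFunc in
/-- The coefficient of `t ^ z` in the Laurent expansion of a rational function at `0`. -/
noncomputable def laurentCoeff (z : ℤ) : RatFunc K →ₗ[K] K where
  toFun f := (algebraMap (RatFunc K) (LaurentSeries K) f).coeff z
  map_add' f g := by simp
  map_smul' r f := by
    have hr : algebraMap (RatFunc K) (LaurentSeries K) (RatFunc.C r) = HahnSeries.C r := by
      rw [← RatFunc.algebraMap_C, ← IsScalarTower.algebraMap_apply]
      simp
    rw [RatFunc.smul_eq_C_mul, map_mul, hr]
    simp

variable {K}

open scoped RatFunc in
lemma algebraMap_monomialT (z : ℤ) :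
    algebraMap (RatFunc K) (LaurentSeries K) (monomialT K z) = HahnSeries.single z 1 := by
  rw [monomialT, map_zpow₀, RatFunc.coe_X, ← RatFunc.single_zpow]

open scoped RatFunc in
lemma laurentCoeff_mul_monomialT (f : RatFunc K) (z w : ℤ) :
    laurentCoeff K (z + w) (f * monomialT K w) = laurentCoeff K z f := by
  simp [laurentCoeff, algebraMap_monomialT, HahnSeries.coeff_mul_single_add]

open scoped RatFunc in
lemma laurentCoeff_monomialT (z w : ℤ) :
    laurentCoeff K z (monomialT K w) = if z = w then 1 else 0 := by
  simp [laurentCoeff, algebraMap_monomialT, HahnSeries.coeff_single]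

/-- Membership of a Laurent polynomial in a monomial subspace is read off its support. -/
lemma mem_monomialSpan_iff {S T : Set ℤ} {f : RatFunc K} (hf : f ∈ monomialSpan K T) :
    f ∈ monomialSpan K S ↔ ∀ z, laurentCoeff K z f ≠ 0 → z ∈ S := by
  constructor
  · intro h z hz
    by_contra hzS
    refine hz ?_
    have : monomialSpan K S ≤ LinearMap.ker (laurentCoeff K z) := by
      refine Submodule.span_le.2 ?_
      rintro _ ⟨w, hw, rfl⟩
      simp only [SetLike.mem_coe, LinearMap.mem_ker, laurentCoeff_monomialT]
      rw [if_neg]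
      rintro rfl
      exact hzS hw
    exact this h
  · intro h
    obtain ⟨c, -, rfl⟩ := (Finsupp.mem_span_image_iff_linearCombination K).1 hf
    have hc : ∀ z, laurentCoeff K z (Finsupp.linearCombination K (monomialT K) c) = c z := by
      intro z
      simp [Finsupp.linearCombination_apply, Finsupp.sum, laurentCoeff_monomialT]
    refine (Finsupp.mem_span_image_iff_linearCombination K).2 ⟨c, fun z hz => h z ?_, rfl⟩
    rw [hc]
    exact Finsupp.mem_support_iff.1 hz

lemma monomialT_mem_monomialSpan {S : Set ℤ} {z : ℤ} :
    monomialT K z ∈ monomialSpan K S ↔ z ∈ S := by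
  refine ⟨fun h => (mem_monomialSpan_iff h).1 h z (by simp [laurentCoeff_monomialT]),
    fun h => Submodule.subset_span ⟨z, h, rfl⟩⟩

lemma mul_mem_monomialSpan {S T U : Set ℤ} (h : ∀ x ∈ S, ∀ y ∈ T, x + y ∈ U) {f g : RatFunc K}
    (hf : f ∈ monomialSpan K S) (hg : g ∈ monomialSpan K T) : f * g ∈ monomialSpan K U := by
  have key : monomialSpan K S * monomialSpan K T ≤ monomialSpan K U := by
    rw [monomialSpan, monomialSpan, Submodule.span_mul_span]
    refine Submodule.span_le.2 ?_
    rintro _ ⟨_, ⟨x, hx, rfl⟩, _, ⟨y, hy, rfl⟩, rfl⟩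
    simp only [SetLike.mem_coe]
    rw [← monomialT_add, monomialT_mem_monomialSpan]
    exact h x hx y hy
  exact key (Submodule.mul_mem_mul hf hg)

end Monomial

/-! ### The canonical module and its dual in terms of exponents -/

section SemigroupRing

variable (K : Type*) [Field K] (Γ : AddSubmonoid ℕ)

/-- A submonoid of `ℕ`, viewed inside `ℤ`. -/
def toIntSubmonoid : AddSubmonoid ℤ := Γ.map (Nat.castAddMonoidHom ℤ)

variable {Γ}

lemma mem_toIntSubmonoid {z : ℤ} : z ∈ toIntSubmonoid Γ ↔ ∃ a ∈ Γ, (a : ℤ) = z := Iff.rfl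

lemma natCast_mem_toIntSubmonoid {a : ℕ} : (a : ℤ) ∈ toIntSubmonoid Γ ↔ a ∈ Γ := by
  simp [mem_toIntSubmonoid]

lemma IsNumericalSemigroup.isRightCofinite (h : IsNumericalSemigroup Γ) :
    IsRightCofinite (toIntSubmonoid Γ : Set ℤ) := by
  obtain ⟨N, hN⟩ := h.bddAbove
  refine ⟨⟨0, ?_⟩, ⟨N + 1, fun z hz => ?_⟩⟩
  · rintro _ ⟨a, -, rfl⟩
    simp
  · lift z to ℕ using by omega
    refine natCast_mem_toIntSubmonoid.2 ?_
    by_contra hzΓ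
    have := hN hzΓ
    omega

lemma mem_semigroupRing_iff {f : RatFunc K} :
    f ∈ semigroupRing K Γ ↔ f ∈ monomialSpan K (toIntSubmonoid Γ) := by
  let M : Submonoid (RatFunc K) :=
    { carrier := {f | ∃ s ∈ Γ, f = monomialT K (s : ℤ)}
      one_mem' := ⟨0, Γ.zero_mem, (monomialT_zero K).symm⟩
      mul_mem' := by
        rintro _ _ ⟨a, ha, rfl⟩ ⟨b, hb, rfl⟩
        exact ⟨a + b, Γ.add_mem ha hb, by push_cast; exact (monomialT_add K _ _).symm⟩ }
  have hM : (M : Set (RatFunc K)) = monomialT K '' (toIntSubmonoid Γ : Set ℤ) := by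
    ext f
    constructor
    · rintro ⟨a, ha, rfl⟩
      exact ⟨a, natCast_mem_toIntSubmonoid.2 ha, rfl⟩
    · rintro ⟨_, ⟨a, ha, rfl⟩, rfl⟩
      exact ⟨a, ha, rfl⟩
  have h := Algebra.adjoin_eq_span_of_subset (R := K) (s := (M : Set (RatFunc K)))
    (by rw [Submonoid.closure_eq]; exact Submodule.subset_span)
  rw [hM] at h
  rw [← Subalgebra.mem_toSubmodule, semigroupRing, monomialSpan, ← h, ← hM]
  rfl

/-- `-PF(Γ)` generates the canonical exponents: a maximal element of
`(-w + Γ) \ Γ` is a pseudo-Frobenius number. -/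
lemma exists_pseudoFrobenius_add (hΓ : IsNumericalSemigroup Γ) {w : ℤ}
    (hw : w ∈ canonicalExponents (toIntSubmonoid Γ : Set ℤ)) :
    ∃ ν ∈ pseudoFrobenius Γ, ∃ s ∈ toIntSubmonoid Γ, w = -ν + s := by
  obtain ⟨N, hN⟩ := hΓ.isRightCofinite.eventually_mem
  obtain ⟨ν, ⟨hν, s, hs, hsν⟩, hmax⟩ := Int.exists_greatest_of_bdd
    (P := fun ν => ν ∉ toIntSubmonoid Γ ∧ ∃ s ∈ toIntSubmonoid Γ, w = -ν + s)
    ⟨N, fun ν hν => by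
      by_contra! h
      exact hν.1 (hN _ h.le)⟩
    ⟨-w, hw, 0, zero_mem _, by simp⟩
  refine ⟨ν, ⟨hν, fun a ha ha0 => ?_⟩, s, hs, hsν⟩
  by_contra h
  have := hmax (ν + a) ⟨h, s + a, add_mem hs (natCast_mem_toIntSubmonoid.2 ha), by
    rw [hsν]; ring⟩
  omega

lemma mem_canonicalModule_iff (hΓ : IsNumericalSemigroup Γ) {f : RatFunc K} :
    f ∈ canonicalModule K Γ ↔
      f ∈ monomialSpan K (canonicalExponents (toIntSubmonoid Γ : Set ℤ)) := by
  constructor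
  · intro hf
    induction hf using Submodule.span_induction with
    | mem x hx =>
      obtain ⟨ν, hν, rfl⟩ := hx
      refine monomialT_mem_monomialSpan.2 ?_
      rw [canonicalExponents, Set.mem_ofPred_eq, neg_neg]
      exact hν.1
    | zero => exact zero_mem _
    | add x y _ _ hx hy => exact add_mem hx hy
    | smul a x _ hx =>
      exact mul_mem_monomialSpan (fun s hs w hw => by
        rw [add_comm]
        exact canonicalExponents_add_mem hw hs) ((mem_semigroupRing_iff K).1 a.2) hx
  · intro hf
    have : monomialSpan K (canonicalExponents (toIntSubmonoid Γ : Set ℤ)) ≤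
        (canonicalModule K Γ).restrictScalars K := by
      refine Submodule.span_le.2 ?_
      rintro _ ⟨w, hw, rfl⟩
      obtain ⟨ν, hν, s, hs, rfl⟩ := exists_pseudoFrobenius_add hΓ hw
      have hs' : monomialT K s ∈ semigroupRing K Γ :=
        (mem_semigroupRing_iff K).2 (monomialT_mem_monomialSpan.2 hs)
      rw [add_comm, monomialT_add]
      exact (canonicalModule K Γ).smul_mem (⟨_, hs'⟩ : semigroupRing K Γ)
        (Submodule.subset_span ⟨ν, hν, rfl⟩)
    exact this hf

lemma mem_anticanonicalIdeal_iff (hΓ : IsNumericalSemigroup Γ) {f : RatFunc K} :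
    f ∈ anticanonicalIdeal K Γ ↔
      f ∈ monomialSpan K (anticanonicalExponents (toIntSubmonoid Γ : Set ℤ)) := by
  have hdiv : f ∈ anticanonicalIdeal K Γ ↔ ∀ g ∈ canonicalModule K Γ,
      f * g ∈ monomialSpan K (toIntSubmonoid Γ : Set ℤ) := by
    rw [anticanonicalIdeal, Submodule.mem_div_iff_forall_mul_mem]
    refine forall₂_congr fun g _ => ?_
    rw [← mem_semigroupRing_iff, Submodule.mem_one]
    exact ⟨fun ⟨y, hy⟩ => hy ▸ y.2, fun h => ⟨⟨_, h⟩, rfl⟩⟩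
  rw [hdiv]
  constructor
  · intro h
    have hmul : ∀ w ∈ canonicalExponents (toIntSubmonoid Γ : Set ℤ),
        f * monomialT K w ∈ monomialSpan K (toIntSubmonoid Γ : Set ℤ) := fun w hw =>
      h _ ((mem_canonicalModule_iff K hΓ).2 (monomialT_mem_monomialSpan.2 hw))
    -- Multiplying by `t ^ (-N)` shows that `f` is a Laurent polynomial.
    have hf : f ∈ monomialSpan K (Set.univ : Set ℤ) := by
      obtain ⟨N, hN⟩ := (canonicalExponents_isRightCofinite hΓ.isRightCofinite).eventually_mem
      have := mul_mem_monomialSpan (U := Set.univ) (fun _ _ _ _ => trivial) (hmul N (hN N le_rfl))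
        (monomialT_mem_monomialSpan.2 (Set.mem_univ (-N)))
      rwa [mul_assoc, ← monomialT_add, add_neg_cancel, monomialT_zero, mul_one] at this
    refine (mem_monomialSpan_iff hf).2 fun z hz w hw => ?_
    refine (mem_monomialSpan_iff (hmul w hw)).1 (hmul w hw) (z + w) ?_
    rwa [laurentCoeff_mul_monomialT]
  · intro hf g hg
    exact mul_mem_monomialSpan (fun y (hy : y ∈ anticanonicalExponents _) w hw => hy w hw) hf
      ((mem_canonicalModule_iff K hΓ).1 hg)

/-- The semigroup trace does not depend on the field. -/
lemma semigroupTrace_eq (hΓ : IsNumericalSemigroup Γ) :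
    semigroupTrace K Γ = traceExponents (toIntSubmonoid Γ : Set ℤ) := by
  have h1 : monomialExponents (canonicalModule K Γ : Set (RatFunc K)) =
      canonicalExponents (toIntSubmonoid Γ : Set ℤ) := by
    ext z
    exact (mem_canonicalModule_iff K hΓ).trans monomialT_mem_monomialSpan
  have h2 : monomialExponents (anticanonicalIdeal K Γ : Set (RatFunc K)) =
      anticanonicalExponents (toIntSubmonoid Γ : Set ℤ) := by
    ext z
    exact (mem_anticanonicalIdeal_iff K hΓ).trans monomialT_mem_monomialSpan
  rw [semigroupTrace, h1, h2]
  rfl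

/-! ### The trace ideal and the residue -/

set_option synthInstance.maxHeartbeats 200000 in
/-- Every homomorphism from the canonical module to the semigroup ring is multiplication by an
element of the anticanonical ideal. -/
lemma exists_anticanonical_mul_eq (hΓ : IsNumericalSemigroup Γ)
    (φ : canonicalModule K Γ →ₗ[semigroupRing K Γ] semigroupRing K Γ) :
    ∃ x ∈ anticanonicalIdeal K Γ, ∀ u : canonicalModule K Γ, (φ u : RatFunc K) = x * u := by
  obtain ⟨M, hM⟩ := (canonicalExponents_isRightCofinite hΓ.isRightCofinite).eventually_mem
  obtain ⟨N, hN⟩ := (anticanonicalExponents_isRightCofinite hΓ.isRightCofinite).eventually_mem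
  let w : canonicalModule K Γ :=
    ⟨monomialT K M, (mem_canonicalModule_iff K hΓ).2 (monomialT_mem_monomialSpan.2 (hM M le_rfl))⟩
  have hw : (w : RatFunc K) ≠ 0 := monomialT_ne_zero K M
  have hmul : ∀ u : canonicalModule K Γ, (φ u : RatFunc K) = (φ w : RatFunc K) / w * u := by
    intro u
    -- Clearing denominators with the anticanonical monomial `t ^ N`.
    have hA : ∀ v : canonicalModule K Γ, monomialT K N * (v : RatFunc K) ∈ semigroupRing K Γ :=
      fun v => (mem_semigroupRing_iff K).2 <|
        mul_mem_monomialSpan (S := anticanonicalExponents (toIntSubmonoid Γ : Set ℤ))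
          (fun y hy w hw => hy w hw) (monomialT_mem_monomialSpan.2 (hN N le_rfl))
          ((mem_canonicalModule_iff K hΓ).1 v.2)
    have hsmul : (⟨_, hA w⟩ : semigroupRing K Γ) • u = (⟨_, hA u⟩ : semigroupRing K Γ) • w :=
      Subtype.ext (show monomialT K N * (w : RatFunc K) * u = monomialT K N * (u : RatFunc K) * w
        by ring)
    have h := congrArg (fun a => ((φ a : semigroupRing K Γ) : RatFunc K)) hsmul
    simp only [map_smul, smul_eq_mul, MulMemClass.coe_mul, mul_assoc] at h
    have h' := mul_left_cancel₀ (monomialT_ne_zero K N) h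
    field_simp
    linear_combination h'
  refine ⟨_, ?_, hmul⟩
  rw [anticanonicalIdeal, Submodule.mem_div_iff_forall_mul_mem]
  intro g hg
  rw [← hmul ⟨g, hg⟩]
  exact Submodule.mem_one.2 ⟨_, rfl⟩

lemma mem_traceIdeal_iff (hΓ : IsNumericalSemigroup Γ) {a : semigroupRing K Γ} :
    a ∈ traceIdeal (semigroupRing K Γ) (canonicalModule K Γ) ↔
      (a : RatFunc K) ∈ monomialSpan K (traceExponents (toIntSubmonoid Γ : Set ℤ)) := by
  constructor
  · intro ha
    induction ha using Submodule.iSup_induction' with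
    | mem φ _ h =>
      obtain ⟨u, rfl⟩ := h
      obtain ⟨x, hx, hxφ⟩ := exists_anticanonical_mul_eq K hΓ φ
      rw [hxφ]
      exact mul_mem_monomialSpan (U := traceExponents (toIntSubmonoid Γ : Set ℤ))
        (fun y hy w hw => ⟨w, hw, y, hy, add_comm _ _⟩)
        ((mem_anticanonicalIdeal_iff K hΓ).1 hx) ((mem_canonicalModule_iff K hΓ).1 u.2)
    | zero => exact zero_mem _
    | add x y _ _ hx hy => exact add_mem hx hy
  · intro ha
    have hle : monomialSpan K (traceExponents (toIntSubmonoid Γ : Set ℤ)) ≤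
        ((traceIdeal (semigroupRing K Γ) (canonicalModule K Γ)).restrictScalars K).map
          (semigroupRing K Γ).val.toLinearMap := by
      refine Submodule.span_le.2 ?_
      rintro _ ⟨_, ⟨w, hw, y, hy, rfl⟩, rfl⟩
      have hmem : ∀ u : canonicalModule K Γ, monomialT K y * (u : RatFunc K) ∈ semigroupRing K Γ :=
        fun u => (mem_semigroupRing_iff K).2 <|
          mul_mem_monomialSpan (fun y (hy : y ∈ anticanonicalExponents _) w hw => hy w hw)
          (monomialT_mem_monomialSpan.2 hy) ((mem_canonicalModule_iff K hΓ).1 u.2)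
      let φ : canonicalModule K Γ →ₗ[semigroupRing K Γ] semigroupRing K Γ :=
        { toFun := fun u => ⟨_, hmem u⟩
          map_add' := fun u v => Subtype.ext (mul_add _ _ _)
          map_smul' := fun r u => Subtype.ext (mul_left_comm _ _ _) }
      refine ⟨φ ⟨monomialT K w, (mem_canonicalModule_iff K hΓ).2
        (monomialT_mem_monomialSpan.2 hw)⟩, ?_, ?_⟩
      · exact Submodule.mem_iSup_of_mem φ ⟨_, rfl⟩
      · exact (mul_comm _ _).trans (monomialT_add K w y).symm
    obtain ⟨b, hb, hba⟩ := hle ha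
    rwa [show a = b from Subtype.ext hba.symm]

lemma finite_diff_traceExponents (hΓ : IsNumericalSemigroup Γ) :
    ((toIntSubmonoid Γ : Set ℤ) \ traceExponents (toIntSubmonoid Γ : Set ℤ)).Finite := by
  obtain ⟨B, hB⟩ := hΓ.isRightCofinite.bddBelow
  obtain ⟨N, hN⟩ := (traceExponents_isRightCofinite hΓ.isRightCofinite).eventually_mem
  refine (Set.finite_Icc B N).subset fun z hz => ⟨hB z hz.1, ?_⟩
  by_contra! h
  exact hz.2 (hN z h.le)

/-- The residue counts the elements of `Γ` outside the trace: their monomials form a basis of the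
quotient by the trace ideal. -/
lemma residue_eq_encard (hΓ : IsNumericalSemigroup Γ) :
    residue K Γ =
      ((toIntSubmonoid Γ : Set ℤ) \ traceExponents (toIntSubmonoid Γ : Set ℤ)).encard := by
  set D : Set ℤ := (toIntSubmonoid Γ : Set ℤ) \ traceExponents (toIntSubmonoid Γ : Set ℤ)
  have : Fintype D := (finite_diff_traceExponents hΓ).fintype
  let g : semigroupRing K Γ →ₗ[K] (D → K) :=
    LinearMap.pi fun z => laurentCoeff K z ∘ₗ (semigroupRing K Γ).val.toLinearMap
  have hker : (traceIdeal (semigroupRing K Γ) (canonicalModule K Γ)).restrictScalars K =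
      LinearMap.ker g := by
    ext a
    have haΓ := (mem_semigroupRing_iff K).1 a.2
    rw [Submodule.restrictScalars_mem, mem_traceIdeal_iff K hΓ, mem_monomialSpan_iff haΓ,
      LinearMap.mem_ker, funext_iff]
    constructor
    · rintro h ⟨z, hz⟩
      by_contra hne
      exact hz.2 (h z hne)
    · intro h z hz
      by_contra hzt
      exact hz (h ⟨z, (mem_monomialSpan_iff haΓ).1 haΓ z hz, hzt⟩)
  have hsurj : Function.Surjective g := by
    intro c
    refine ⟨⟨∑ z : D, c z • monomialT K z, sum_mem fun z _ => Subalgebra.smul_mem _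
      ((mem_semigroupRing_iff K).2 (monomialT_mem_monomialSpan.2 z.2.1)) _⟩, ?_⟩
    ext z
    simp [g, laurentCoeff_monomialT, Subtype.coe_inj]
  have e := (Submodule.Quotient.restrictScalarsEquiv K
    (traceIdeal (semigroupRing K Γ) (canonicalModule K Γ))).symm.trans
      ((Submodule.quotEquivOfEq _ _ hker).trans (g.quotKerEquivOfSurjective hsurj))
  rw [residue, e.rank_eq, rank_fun']
  rw [map_natCast, Set.encard_eq_coe_toFinset_card, Set.toFinset_card]

end SemigroupRing

/-! ### Gluings -/

section Gluing

variable {l k : ℕ} (m : Fin l → ℕ) (n : Fin k → ℕ) (lam mu : ℕ)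

lemma toIntSubmonoid_gluing :
    (toIntSubmonoid (gluing m n lam mu) : Set ℤ) =
      weightedSum mu lam (toIntSubmonoid (semigroupGeneratedBy m))
        (toIntSubmonoid (semigroupGeneratedBy n)) := by
  have hmul : ∀ {e : ℕ} (c : ℕ) (v : Fin e → ℕ),
      AddSubmonoid.closure (Set.range fun i => c * v i) =
        (semigroupGeneratedBy v).map (AddMonoidHom.mulLeft c) := by
    intro e c v
    rw [semigroupGeneratedBy, AddMonoidHom.map_mclosure, ← Set.range_comp]
    rfl
  ext z
  constructor
  · rintro ⟨a, ha, rfl⟩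
    rw [gluing, SetLike.mem_coe, AddSubmonoid.closure_union, hmul, hmul, AddSubmonoid.mem_sup] at ha
    obtain ⟨_, ⟨x, hx, rfl⟩, _, ⟨y, hy, rfl⟩, rfl⟩ := ha
    exact ⟨x, natCast_mem_toIntSubmonoid.2 hx, y, natCast_mem_toIntSubmonoid.2 hy, by simp⟩
  · rintro ⟨_, ⟨x, hx, rfl⟩, _, ⟨y, hy, rfl⟩, rfl⟩
    refine ⟨mu * x + lam * y, ?_, by simp⟩
    rw [gluing, SetLike.mem_coe, AddSubmonoid.closure_union, hmul, hmul, AddSubmonoid.mem_sup]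
    exact ⟨_, ⟨x, hx, rfl⟩, _, ⟨y, hy, rfl⟩, rfl⟩

variable {m n lam mu}

lemma IsGluingData.isCoprime (h : IsGluingData m n lam mu) : IsCoprime (mu : ℤ) (lam : ℤ) :=
  (Nat.isCoprime_iff_coprime.2 h.coprime).symm

lemma IsGluingData.isNumericalSemigroup (h : IsGluingData m n lam mu) :
    IsNumericalSemigroup (gluing m n lam mu) := by
  have hG := IsRightCofinite.weightedSum (by exact_mod_cast h.mu_pos) (by exact_mod_cast h.lam_pos)
    h.isCoprime h.left.numerical.isRightCofinite h.right.numerical.isRightCofinite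
  rw [← toIntSubmonoid_gluing] at hG
  obtain ⟨N, hN⟩ := hG.eventually_mem
  refine (Set.finite_Iic N.toNat).subset fun a ha => ?_
  by_contra hlt
  simp only [Set.mem_Iic, not_le] at hlt
  exact ha (natCast_mem_toIntSubmonoid.1 (hN a (by omega)))

end Gluing

theorem theorem4p2 (K : Type*) [Field K] {l k : ℕ} (m : Fin l → ℕ) (n : Fin k → ℕ) (lam mu : ℕ)
    (h : IsGluingData m n lam mu) :
    semigroupTrace K (gluing m n lam mu) =
        {z : ℤ | ∃ x ∈ semigroupTrace K (semigroupGeneratedBy m),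
          ∃ y ∈ semigroupTrace K (semigroupGeneratedBy n), z = (mu : ℤ) * x + (lam : ℤ) * y} ∧
      residue K (gluing m n lam mu) ≠ ⊤ ∧
      residue K (gluing m n lam mu) =
        (mu : ℕ∞) * residue K (semigroupGeneratedBy m) +
          (lam : ℕ∞) * residue K (semigroupGeneratedBy n) := by
  have hΓ := h.isNumericalSemigroup
  have h₁ := h.left.numerical
  have h₂ := h.right.numerical
  have hlam := natCast_mem_toIntSubmonoid.2 h.lam_mem
  have hmu := natCast_mem_toIntSubmonoid.2 h.mu_mem
  have htr := traceExponents_weightedSum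
    (by exact_mod_cast h.lam_pos) h.isCoprime h₁.isRightCofinite hlam hmu
  rw [semigroupTrace_eq K hΓ, semigroupTrace_eq K h₁, semigroupTrace_eq K h₂]
  refine ⟨by rw [toIntSubmonoid_gluing, htr]; rfl, ?_, ?_⟩
  · rw [residue_eq_encard K hΓ]
    exact (finite_diff_traceExponents hΓ).encard_lt_top.ne
  · rw [residue_eq_encard K hΓ, residue_eq_encard K h₁, residue_eq_encard K h₂,
      toIntSubmonoid_gluing, htr]
    exact encard_weightedSum_diff h.mu_pos h.lam_pos h.isCoprime
      (traceExponents_subset _) (traceExponents_subset _)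
      (fun z hz => add_mem hz hlam) (fun z hz => traceExponents_add_mem hz hlam)
      (fun z hz => add_mem hz hmu) (fun z hz => traceExponents_add_mem hz hmu)
      (traceExponents_isRightCofinite h₁.isRightCofinite) h₂.isRightCofinite
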